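/- Theorem 2.2. Let $n,N\ge 0$ be integers. Let $\mathcal A$ be the graded-commutative real algebra of polynomials (without explicit dependence on the spacetime coordinates $x^\mu$, $\mu=1,\dots,n$) in the following variables and all their formal partial derivatives, where $a=1,\dots,N$: the commuting symmetric fields $h^a_{\alpha\beta}=h^a_{\beta\alpha}$ (antighost number $0$), the anticommuting symmetric antifields $h^{*\alpha\beta}_a=h^{*\beta\alpha}_a$ (antighost number $1$), and the commuting antifields $C^{*\alpha}_a$ (antighost number $2$); derivatives preserve the antighost number, and distinct jets are independent apart from the symmetry of partial derivatives and of the index pairs. Let $\partial_\mu$ be the total derivative on $\mathcal A$ (the even derivation adding one derivative index $\mu$ to every variable), and let $d=dx^\mu\,\partial_\mu$ act on exterior forms in the $dx^\mu$ with coefficients in $\mathcal A$. Let $$K^a_{\alpha\beta\mu\nu}=-\tfrac12\left(\partial_\alpha\partial_\mu h^a_{\beta\nu}+\partial_\beta\partial_\nu h^a_{\alpha\mu}-\partial_\alpha\partial_\nu h^a_{\beta\mu}-\partial_\beta\partial_\mu h^a_{\alpha\nu}\right)$$ be the linearized Riemann curvature of $h^a$. An *invariant polynomial* of form degree $p$ is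 a $p$-form all of whose coefficients lie in the subalgebra of $\mathcal A$ generated by the $K^a_{\alpha\beta\mu\nu}$, $h^{*\alpha\beta}_a$, $C^{*\alpha}_a$ and all their derivatives. Then the cohomology of $d$ in the space of invariant polynomials is trivial in form degree less than $n$ and antighost number strictly greater than $0$. That is, if $0\le p<n$, $k>0$, and $\alpha$ is an invariant polynomial of form degree $p$ and antighost number $k$ with $d\alpha=0$, then $\alpha=d\beta$ for some invariant polynomial $\beta$ of form degree $p-1$ and antighost number $k$ (for $p=0$ this means $\alpha=0$). -/

import Mathlib

noncomputable section

namespace FreeSpinTwo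

/-- Commuting jet variables in spacetime dimension `n` for `N` fields.  `h m a s(α, β)` is the
partial derivative `∂_m h^a_{αβ}` (`m` a multi-index) of the symmetric tensor field `h^a`, and
`Cstar m a α` is the partial derivative `∂_m C*_a^α` of the (even) antifield `C*` conjugate to the
ghosts. -/
inductive EvenJet (n N : ℕ) : Type
  | h (m : Fin n →₀ ℕ) (a : Fin N) (s : Sym2 (Fin n)) : EvenJet n N
  | Cstar (m : Fin n →₀ ℕ) (a : Fin N) (α : Fin n) : EvenJet n N

/-- Anticommuting jet variables: `hstar m a s(α, β)` is the partial derivative `∂_m h*_a^{αβ}` of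
the (odd) antifield conjugate to `h^a_{αβ}`, symmetric in `α, β`. -/
inductive OddJet (n N : ℕ) : Type
  | hstar (m : Fin n →₀ ℕ) (a : Fin N) (s : Sym2 (Fin n)) : OddJet n N

/-- The jet variable obtained by one further derivative in the direction `μ`. -/
def EvenJet.shift {n N : ℕ} (μ : Fin n) : EvenJet n N → EvenJet n N
  | .h m a s => .h (m + Finsupp.single μ 1) a s
  | .Cstar m a α => .Cstar (m + Finsupp.single μ 1) a α

/-- The jet variable obtained by one further derivative in the direction `μ`. -/
def OddJet.shift {n N : ℕ} (μ : Fin n) : OddJet n N → OddJet n N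
  | .hstar m a s => .hstar (m + Finsupp.single μ 1) a s

/-- Antighost number of the commuting jet variables: `0` for `h`, `2` for `C*`. -/
def EvenJet.antigh {n N : ℕ} : EvenJet n N → ℕ
  | .h _ _ _ => 0
  | .Cstar _ _ _ => 2

/-- The polynomial algebra on the commuting jet variables. -/
abbrev EvenPart (n N : ℕ) : Type := MvPolynomial (EvenJet n N) ℝ

/-- The Grassmann algebra on the anticommuting jet variables. -/
abbrev OddPart (n N : ℕ) : Type := ExteriorAlgebra ℝ (OddJet n N →₀ ℝ)

/-- Ghost-free local functions: real polynomials, without explicit dependence on the spacetime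
coordinates, in the fields `h`, the antifields `h*`, `C*` and all their partial derivatives. -/
abbrev LocalFun (n N : ℕ) : Type := TensorProduct ℝ (EvenPart n N) (OddPart n N)

/-- The algebra homomorphism `v ↦ v + ε f(v)` from a Grassmann algebra to its dual numbers. -/
def extDerHom {V : Type*} [AddCommGroup V] [Module ℝ V] (f : V →ₗ[ℝ] V) :
    ExteriorAlgebra ℝ V →ₐ[ℝ] DualNumber (ExteriorAlgebra ℝ V) :=
  ExteriorAlgebra.lift ℝ
    ⟨(TrivSqZeroExt.inlAlgHom ℝ (ExteriorAlgebra ℝ V) (ExteriorAlgebra ℝ V)).toLinearMap ∘ₗ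
        ExteriorAlgebra.ι ℝ +
      ((TrivSqZeroExt.inrHom (ExteriorAlgebra ℝ V) (ExteriorAlgebra ℝ V)).restrictScalars ℝ) ∘ₗ
        ExteriorAlgebra.ι ℝ ∘ₗ f, by
      intro v
      ext
      · simp
      · simp [ExteriorAlgebra.ι_add_mul_swap (R := ℝ) v (f v)]⟩

/-- The unique (even) derivation of the Grassmann algebra that extends the linear map `f` of its
space of generators: the `ε`-coefficient of `extDerHom f`. -/
def extDer {V : Type*} [AddCommGroup V] [Module ℝ V] (f : V →ₗ[ℝ] V) :
    ExteriorAlgebra ℝ V →ₗ[ℝ] ExteriorAlgebra ℝ V :=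
  ((TrivSqZeroExt.sndHom (ExteriorAlgebra ℝ V) (ExteriorAlgebra ℝ V)).restrictScalars ℝ) ∘ₗ
    (extDerHom f).toLinearMap

theorem extDer_ι {V : Type*} [AddCommGroup V] [Module ℝ V] (f : V →ₗ[ℝ] V) (v : V) :
    extDer f (ExteriorAlgebra.ι ℝ v) = ExteriorAlgebra.ι ℝ (f v) := by
  simp [extDer, extDerHom]

theorem extDer_mul {V : Type*} [AddCommGroup V] [Module ℝ V] (f : V →ₗ[ℝ] V)
    (x y : ExteriorAlgebra ℝ V) :
    extDer f (x * y) = extDer f x * y + x * extDer f y := by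
  have key : ∀ z : ExteriorAlgebra ℝ V, (extDerHom f z).fst = z := by
    intro z
    have h : (TrivSqZeroExt.fstHom ℝ (ExteriorAlgebra ℝ V) (ExteriorAlgebra ℝ V)).comp
        (extDerHom f) = AlgHom.id ℝ _ := by
      ext v
      simp [extDerHom]
    exact DFunLike.congr_fun h z
  simp [extDer, key, add_comm]

variable {n N : ℕ}

/-- The total derivative `∂_μ`: the (even) derivation of the algebra of local functions that sends
every jet variable to the jet variable with one more derivative in the direction `μ`. -/
def totalDeriv (μ : Fin n) : LocalFun n N →ₗ[ℝ] LocalFun n N :=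
  LinearMap.rTensor (OddPart n N)
      (MvPolynomial.mkDerivation ℝ
        (fun j : EvenJet n N => (MvPolynomial.X (j.shift μ) : EvenPart n N))).toLinearMap +
    LinearMap.lTensor (EvenPart n N) (extDer (Finsupp.lmapDomain ℝ ℝ (OddJet.shift μ)))

/-- The iterated total derivative `∂_{μ₁} ⋯ ∂_{μ_k}`. -/
def iterTotalDeriv (l : List (Fin n)) (x : LocalFun n N) : LocalFun n N :=
  l.foldr (fun μ y => totalDeriv μ y) x

/-- The field `h^a_{αβ}` as a local function. -/
def hField (a : Fin N) (α β : Fin n) : LocalFun n N :=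
  TensorProduct.tmul ℝ (MvPolynomial.X (EvenJet.h 0 a s(α, β))) 1

/-- The antifield `h*_a^{αβ}` as a local function. -/
def hStar (a : Fin N) (α β : Fin n) : LocalFun n N :=
  TensorProduct.tmul ℝ 1 (ExteriorAlgebra.ι ℝ (Finsupp.single (OddJet.hstar 0 a s(α, β)) 1))

/-- The antifield `C*_a^α` as a local function. -/
def CStar (a : Fin N) (α : Fin n) : LocalFun n N :=
  TensorProduct.tmul ℝ (MvPolynomial.X (EvenJet.Cstar 0 a α)) 1

/-- The linearized Riemann tensor `K^a_{αβμν}` of `h^a`: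
`K_{αβμν} = -(1/2) (∂_α∂_μ h_{βν} + ∂_β∂_ν h_{αμ} - ∂_α∂_ν h_{βμ} - ∂_β∂_μ h_{αν})`. -/
def curvature (a : Fin N) (α β μ ν : Fin n) : LocalFun n N :=
  (-(1 / 2) : ℝ) •
    (totalDeriv α (totalDeriv μ (hField a β ν)) + totalDeriv β (totalDeriv ν (hField a α μ))
      - totalDeriv α (totalDeriv ν (hField a β μ)) - totalDeriv β (totalDeriv μ (hField a α ν)))

/-- The linearized curvatures and the antifields. -/
inductive IsBasicInvariant : LocalFun n N → Prop
  | curvature (a : Fin N) (α β μ ν : Fin n) : IsBasicInvariant (curvature a α β μ ν)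
  | hStar (a : Fin N) (α β : Fin n) : IsBasicInvariant (hStar a α β)
  | CStar (a : Fin N) (α : Fin n) : IsBasicInvariant (CStar a α)

variable (n N) in
/-- The invariant polynomials (of form degree zero): polynomials in the linearized curvatures, the
antifields `h*`, `C*`, and all their derivatives. -/
def invariantPolynomials : Subalgebra ℝ (LocalFun n N) :=
  Algebra.adjoin ℝ
    {x | ∃ (l : List (Fin n)) (g : LocalFun n N), IsBasicInvariant g ∧ x = iterTotalDeriv l g}

variable (n N) in
/-- The local functions of antighost number `k`: sums of products of an even polynomial of
antighost number `i` and of `j` odd variables, each of antighost number `1`, with `i + j = k`. -/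
def antighostSubmodule (k : ℕ) : Submodule ℝ (LocalFun n N) :=
  ⨆ ij ∈ Finset.HasAntidiagonal.antidiagonal k,
    Submodule.map₂ (TensorProduct.mk ℝ (EvenPart n N) (OddPart n N))
      (MvPolynomial.weightedHomogeneousSubmodule ℝ (EvenJet.antigh (n := n) (N := N)) ij.1)
      (⋀[ℝ]^ij.2 (OddJet n N →₀ ℝ))

variable (n N) in
/-- Local `p`-forms `ω = ∑ dx^{μ₁} ⋯ dx^{μ_p} ω_{μ₁…μ_p}` with local functions as coefficients,
viewed as alternating multilinear functions of `p` constant vectors of `ℝⁿ`. -/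
abbrev LocalForm (p : ℕ) : Type := (Fin n → ℝ) [⋀^Fin p]→ₗ[ℝ] LocalFun n N

/-- The total derivative `v ↦ ∂_v = ∑ v^μ ∂_μ` along a constant vector. -/
def directionalDeriv : (Fin n → ℝ) →ₗ[ℝ] (LocalFun n N →ₗ[ℝ] LocalFun n N) :=
  ∑ μ : Fin n, (LinearMap.proj μ : (Fin n → ℝ) →ₗ[ℝ] ℝ).smulRight (totalDeriv μ)

/-- The horizontal exterior derivative `d = dx^μ ∂_μ`, that is
`(dω)(v₀, …, v_p) = ∑ i, (-1)^i ∂_{v_i} (ω (v₀, …, v̂_i, …, v_p))`. -/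
def horizontalD {p : ℕ} (ω : LocalForm n N p) : LocalForm n N (p + 1) :=
  AlternatingMap.alternatizeUncurryFin
    { toFun := fun v => (directionalDeriv v).compAlternatingMap ω
      map_add' := by intro v w; ext; simp
      map_smul' := by intro c v; ext; simp }

variable (n N) in
/-- The invariant polynomials of form degree `p` and antighost number `k`: the `p`-forms all of
whose coefficients are invariant polynomials of antighost number `k`. -/
def invariantForms (p k : ℕ) : Set (LocalForm n N p) :=
  {ω | ∀ v, ω v ∈ invariantPolynomials n N ∧ ω v ∈ antighostSubmodule n N k}

/-- `ω` is trivial in the cohomology of `d` in the space of invariant polynomials, at antighost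
number `k`: it is `dβ` for an invariant form `β` of form degree one less and of antighost number
`k`.  There are no forms of negative degree, so for a `0`-form this means `ω = 0`. -/
def IsInvariantlyExact (k : ℕ) : {p : ℕ} → LocalForm n N p → Prop
  | 0, ω => ω = 0
  | p + 1, ω => ∃ β : LocalForm n N p, β ∈ invariantForms n N p k ∧ horizontalD β = ω

end FreeSpinTwo

end

/-! The proof is a contracting homotopy built from antifields only. Let `A` be the derivation
counting antighost number, and let `T^ν` be the derivation that kills every `h` jet and sends the
jet `∂_m φ` of an antifield of antighost number `w` to `w m_ν ∂_{m - e_ν} φ`. Then `[T^ν, ∂_μ] =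
δ^ν_μ A` and the `T^ν` commute. Since `A` and `T^ν` vanish on `h`, they vanish on the curvatures;
hence `T^ν` preserves invariant polynomials. All operators live on the whole jet algebra, so the
Bianchi identities among the jets of the curvature never have to be resolved.

Let `i` denote contraction with the `T^ν`. In form degree `p` and antighost number `k`, `d i + i d =
R + k (n - p)` with `R = ∑ ∂_μ T^μ` (`contract_horizontalD_succ`; for `p = 0` the term `d i` is
absent). The operator `R` need not be diagonalised: filter by the subspaces `F_j` killed by all
`j`-fold products of lowerings. These exhaust the algebra (`exists_mem_loweringKernel`), and `R - k
j` maps `F_{j+1}` into `F_j` (`raiseLower_sub_mem_loweringKernel`). A closed form `ω` in `F_{j+1}`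
therefore satisfies `d (i ω) = k (n - p + j) ω + η` with `η` closed, invariant and in `F_j`. The
coefficient is positive for `k > 0` and `p < n`, so induction on `j` finishes the proof. -/

noncomputable section

namespace FreeSpinTwo

/-! ### Derivations of the Grassmann algebra -/

section Grassmann

variable {V : Type*} [AddCommGroup V] [Module ℝ V]

theorem extDer_one (f : V →ₗ[ℝ] V) : extDer f 1 = 0 := by
  simpa using extDer_mul f 1 1

theorem extDer_algebraMap (f : V →ₗ[ℝ] V) (r : ℝ) :
    extDer f (algebraMap ℝ (ExteriorAlgebra ℝ V) r) = 0 := by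
  rw [Algebra.algebraMap_eq_smul_one, map_smul, extDer_one, smul_zero]

/-- The commutator of the derivations extending `f` and `g` extends the commutator of `f`
and `g`. -/
theorem extDer_commutator (f g : V →ₗ[ℝ] V) (x : ExteriorAlgebra ℝ V) :
    extDer f (extDer g x) - extDer g (extDer f x) = extDer (f ∘ₗ g - g ∘ₗ f) x := by
  induction x using ExteriorAlgebra.induction with
  | algebraMap r => simp [extDer_algebraMap]
  | ι v => simp [extDer_ι]
  | mul a b ha hb =>
    simp only [extDer_mul, map_add, ← ha, ← hb]
    noncomm_ring
  | add a b ha hb =>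
    simp only [map_add, ← ha, ← hb]
    abel

theorem extDer_zero (x : ExteriorAlgebra ℝ V) : extDer (0 : V →ₗ[ℝ] V) x = 0 := by
  have h := extDer_commutator (0 : V →ₗ[ℝ] V) 0 x
  have h0 : (0 : V →ₗ[ℝ] V) ∘ₗ (0 : V →ₗ[ℝ] V) - (0 : V →ₗ[ℝ] V) ∘ₗ (0 : V →ₗ[ℝ] V) = 0 :=
    sub_self _
  rw [h0, sub_self] at h
  exact h.symm

theorem extDer_mem_exteriorPower (f : V →ₗ[ℝ] V) {j : ℕ} {x : ExteriorAlgebra ℝ V}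
    (hx : x ∈ ⋀[ℝ]^j V) : extDer f x ∈ ⋀[ℝ]^j V := by
  induction hx using Submodule.pow_induction_on_left' with
  | algebraMap r => simp [extDer_algebraMap]
  | add x y i hx hy ihx ihy => rw [map_add]; exact add_mem ihx ihy
  | mem_mul m hm i x hx ih =>
    obtain ⟨v, rfl⟩ := hm
    rw [extDer_mul, extDer_ι, Nat.succ_eq_add_one, ExteriorAlgebra.exteriorPower, pow_succ']
    exact add_mem (Submodule.mul_mem_mul ⟨f v, rfl⟩ hx) (Submodule.mul_mem_mul ⟨v, rfl⟩ ih)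

/-- The derivation extending the identity counts the degree. -/
theorem extDer_id_of_mem_exteriorPower {j : ℕ} {x : ExteriorAlgebra ℝ V}
    (hx : x ∈ ⋀[ℝ]^j V) : extDer LinearMap.id x = (j : ℝ) • x := by
  induction hx using Submodule.pow_induction_on_left' with
  | algebraMap r => simp [extDer_algebraMap]
  | add x y i hx hy ihx ihy => rw [map_add, ihx, ihy, smul_add]
  | mem_mul m hm i x hx ih =>
    obtain ⟨v, rfl⟩ := hm
    rw [extDer_mul, extDer_ι, ih]
    simp [add_smul, add_comm]

end Grassmann

/-! ### Derivations of polynomial rings and weighted degree -/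

section WeightedDerivation

variable {σ : Type*} {w : σ → ℕ}

theorem isWeightedHomogeneous_mkDerivation_monomial {g : σ → MvPolynomial σ ℝ}
    (hg : ∀ j, MvPolynomial.IsWeightedHomogeneous w (g j) (w j)) (d : σ →₀ ℕ) :
    MvPolynomial.IsWeightedHomogeneous w
      (MvPolynomial.mkDerivation ℝ g (MvPolynomial.monomial d 1)) (Finsupp.weight w d) := by
  induction d using Finsupp.induction_linear with
  | zero =>
    have h : (MvPolynomial.monomial (0 : σ →₀ ℕ) (1 : ℝ)) = 1 := rfl
    rw [h, Derivation.map_one_eq_zero]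
    exact MvPolynomial.isWeightedHomogeneous_zero ℝ w _
  | add s t hs ht =>
    have h : MvPolynomial.monomial (s + t) (1 : ℝ) =
        MvPolynomial.monomial s 1 * MvPolynomial.monomial t 1 := by
      simp [MvPolynomial.monomial_mul]
    rw [h, Derivation.leibniz, smul_eq_mul, smul_eq_mul, map_add]
    refine ((MvPolynomial.isWeightedHomogeneous_monomial w s 1 rfl).mul ht).add ?_
    rw [add_comm]
    exact (MvPolynomial.isWeightedHomogeneous_monomial w t 1 rfl).mul hs
  | single i k =>
    have h : MvPolynomial.monomial (Finsupp.single i k) (1 : ℝ) = MvPolynomial.X i ^ k := by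
      rw [MvPolynomial.X_pow_eq_monomial]
    rw [h, Derivation.leibniz_pow, MvPolynomial.mkDerivation_X, smul_eq_mul]
    rcases k with _ | k
    · simpa using MvPolynomial.isWeightedHomogeneous_zero ℝ w _
    · rw [nsmul_eq_mul, Nat.add_sub_cancel]
      have h1 := (((MvPolynomial.isWeightedHomogeneous_X ℝ w i).pow k).mul (hg i)).C_mul
        ((k + 1 : ℕ) : ℝ)
      simpa [Finsupp.weight_single, add_mul] using h1

theorem isWeightedHomogeneous_mkDerivation {g : σ → MvPolynomial σ ℝ}
    (hg : ∀ j, MvPolynomial.IsWeightedHomogeneous w (g j) (w j)) {i : ℕ} {x : MvPolynomial σ ℝ}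
    (hx : MvPolynomial.IsWeightedHomogeneous w x i) :
    MvPolynomial.IsWeightedHomogeneous w (MvPolynomial.mkDerivation ℝ g x) i := by
  rw [x.as_sum, map_sum]
  refine MvPolynomial.IsWeightedHomogeneous.sum _ _ _ fun d hd => ?_
  rw [← hx (MvPolynomial.mem_support_iff.mp hd), ← mul_one (x.coeff d),
    ← MvPolynomial.C_mul_monomial, ← MvPolynomial.smul_eq_C_mul, Derivation.map_smul, MvPolynomial.smul_eq_C_mul]
  exact (isWeightedHomogeneous_mkDerivation_monomial hg d).C_mul _

/-- Euler's identity: the derivation `X j ↦ w j • X j` counts the weighted degree. -/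
theorem mkDerivation_weight_monomial (w : σ → ℕ) (d : σ →₀ ℕ) :
    MvPolynomial.mkDerivation ℝ (fun j => (w j : ℝ) • (MvPolynomial.X j : MvPolynomial σ ℝ))
      (MvPolynomial.monomial d 1) = (Finsupp.weight w d : ℝ) • MvPolynomial.monomial d 1 := by
  induction d using Finsupp.induction_linear with
  | zero =>
    have h : (MvPolynomial.monomial (0 : σ →₀ ℕ) (1 : ℝ)) = 1 := rfl
    rw [h, Derivation.map_one_eq_zero]
    simp
  | add s t hs ht =>
    have h : MvPolynomial.monomial (s + t) (1 : ℝ) =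
        MvPolynomial.monomial s 1 * MvPolynomial.monomial t 1 := by
      simp [MvPolynomial.monomial_mul]
    rw [h, Derivation.leibniz, smul_eq_mul, smul_eq_mul, map_add, hs, ht, Nat.cast_add, add_smul,
      mul_smul_comm, mul_smul_comm, mul_comm (MvPolynomial.monomial t 1), add_comm]
  | single i k =>
    have h : MvPolynomial.monomial (Finsupp.single i k) (1 : ℝ) = MvPolynomial.X i ^ k := by
      rw [MvPolynomial.X_pow_eq_monomial]
    rw [h, Derivation.leibniz_pow, MvPolynomial.mkDerivation_X, smul_eq_mul]
    rcases k with _ | k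
    · simp
    · rw [Nat.add_sub_cancel, mul_smul_comm, ← pow_succ, Finsupp.weight_single, smul_eq_mul,
        Nat.cast_mul, mul_smul, Nat.cast_smul_eq_nsmul, Nat.cast_smul_eq_nsmul]

theorem mkDerivation_weight_of_isWeightedHomogeneous {i : ℕ} {x : MvPolynomial σ ℝ}
    (hx : MvPolynomial.IsWeightedHomogeneous w x i) :
    MvPolynomial.mkDerivation ℝ (fun j => (w j : ℝ) • (MvPolynomial.X j : MvPolynomial σ ℝ)) x =
      (i : ℝ) • x := by
  conv_lhs => rw [x.as_sum]
  conv_rhs => rw [x.as_sum]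
  rw [map_sum, Finset.smul_sum]
  refine Finset.sum_congr rfl fun d hd => ?_
  rw [← mul_one (x.coeff d), ← MvPolynomial.C_mul_monomial, ← MvPolynomial.smul_eq_C_mul,
    Derivation.map_smul, mkDerivation_weight_monomial, hx (MvPolynomial.mem_support_iff.mp hd), smul_comm]

end WeightedDerivation

variable {n N : ℕ}

/-- The even derivation of the local functions given by `g` on the commuting and by `f` on the
anticommuting jet variables. -/
def jetDer (g : EvenJet n N → EvenPart n N) (f : (OddJet n N →₀ ℝ) →ₗ[ℝ] (OddJet n N →₀ ℝ)) :
    LocalFun n N →ₗ[ℝ] LocalFun n N :=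
  LinearMap.rTensor (OddPart n N) (MvPolynomial.mkDerivation ℝ g).toLinearMap +
    LinearMap.lTensor (EvenPart n N) (extDer f)

/-! ### Even derivations of the local functions -/

section JetDer

open TensorProduct

variable (g g' : EvenJet n N → EvenPart n N)
  (f f' : (OddJet n N →₀ ℝ) →ₗ[ℝ] (OddJet n N →₀ ℝ))

theorem jetDer_tmul (a : EvenPart n N) (b : OddPart n N) :
    jetDer g f (a ⊗ₜ b) = MvPolynomial.mkDerivation ℝ g a ⊗ₜ b + a ⊗ₜ extDer f b := by
  simp [jetDer]

theorem jetDer_X (j : EvenJet n N) :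
    jetDer g f (MvPolynomial.X j ⊗ₜ 1) = g j ⊗ₜ 1 := by
  simp [jetDer_tmul, extDer_one]

theorem jetDer_ι (v : OddJet n N →₀ ℝ) :
    jetDer g f (1 ⊗ₜ ExteriorAlgebra.ι ℝ v) = 1 ⊗ₜ ExteriorAlgebra.ι ℝ (f v) := by
  simp [jetDer_tmul, extDer_ι]

theorem jetDer_mul (x y : LocalFun n N) :
    jetDer g f (x * y) = jetDer g f x * y + x * jetDer g f y := by
  induction x using TensorProduct.induction_on with
  | zero => simp
  | add x x' hx hx' => simp only [add_mul, map_add, hx, hx']; abel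
  | tmul a b =>
    induction y using TensorProduct.induction_on with
    | zero => simp
    | add y y' hy hy' => simp only [mul_add, map_add, hy, hy']; abel
    | tmul a' b' =>
      simp only [jetDer_tmul, Algebra.TensorProduct.tmul_mul_tmul, Derivation.leibniz, extDer_mul,
        smul_eq_mul, add_mul, mul_add, TensorProduct.add_tmul, TensorProduct.tmul_add]
      rw [mul_comm a' (MvPolynomial.mkDerivation ℝ g a)]
      abel

theorem jetDer_algebraMap (r : ℝ) : jetDer g f (algebraMap ℝ (LocalFun n N) r) = 0 := by
  rw [Algebra.TensorProduct.algebraMap_apply, jetDer_tmul, extDer_one]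
  simp [MvPolynomial.algebraMap_eq]

/-- The commutator of two derivations, computed on generators. -/
theorem jetDer_commutator (x : LocalFun n N) :
    jetDer g f (jetDer g' f' x) - jetDer g' f' (jetDer g f x) =
      jetDer (fun j => MvPolynomial.mkDerivation ℝ g (g' j) - MvPolynomial.mkDerivation ℝ g' (g j))
        (f ∘ₗ f' - f' ∘ₗ f) x := by
  have key : ⁅MvPolynomial.mkDerivation ℝ g, MvPolynomial.mkDerivation ℝ g'⁆ =
      MvPolynomial.mkDerivation ℝ (fun j => MvPolynomial.mkDerivation ℝ g (g' j) -
        MvPolynomial.mkDerivation ℝ g' (g j)) := by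
    apply MvPolynomial.derivation_ext
    intro j
    simp [Derivation.commutator_apply]
  induction x using TensorProduct.induction_on with
  | zero => simp
  | add x y hx hy => simp only [map_add, ← hx, ← hy]; abel
  | tmul a b =>
    simp only [jetDer_tmul, map_add, ← key, Derivation.commutator_apply, ← extDer_commutator,
      TensorProduct.sub_tmul, TensorProduct.tmul_sub]
    abel

-- Only the even generators need a hypothesis: all odd generators have antighost number one, so any
-- linear `f` respects the grading.
variable {g f} in
theorem jetDer_mem_antighostSubmodule
    (hg : ∀ j, MvPolynomial.IsWeightedHomogeneous EvenJet.antigh (g j) j.antigh)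
    {k : ℕ} {x : LocalFun n N} (hx : x ∈ antighostSubmodule n N k) :
    jetDer g f x ∈ antighostSubmodule n N k := by
  suffices h : antighostSubmodule n N k ≤ (antighostSubmodule n N k).comap (jetDer g f) from h hx
  refine iSup₂_le fun ij hij => Submodule.map₂_le.mpr fun a ha b hb => ?_
  rw [Submodule.mem_comap, TensorProduct.mk_apply, jetDer_tmul]
  refine Submodule.mem_iSup_of_mem ij (Submodule.mem_iSup_of_mem hij (add_mem ?_ ?_))
  · exact Submodule.apply_mem_map₂ _ (isWeightedHomogeneous_mkDerivation hg ha) hb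
  · exact Submodule.apply_mem_map₂ _ ha (extDer_mem_exteriorPower f hb)

end JetDer

/-! ### Antighost counting, lowering derivations and their commutation relations -/

variable (n N) in
/-- The derivation that multiplies every jet variable by its antighost number. -/
def antighostDer : LocalFun n N →ₗ[ℝ] LocalFun n N :=
  jetDer (fun j => (j.antigh : ℝ) • MvPolynomial.X j) LinearMap.id

theorem antighostDer_of_mem {k : ℕ} {x : LocalFun n N} (hx : x ∈ antighostSubmodule n N k) :
    antighostDer n N x = (k : ℝ) • x := by
  suffices h : antighostSubmodule n N k ≤
      LinearMap.ker (antighostDer n N - (k : ℝ) • LinearMap.id) by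
    simpa [sub_eq_zero] using h hx
  refine iSup₂_le fun ij hij => Submodule.map₂_le.mpr fun a ha b hb => ?_
  have hk := Finset.HasAntidiagonal.mem_antidiagonal.mp hij
  rw [LinearMap.mem_ker, TensorProduct.mk_apply, LinearMap.sub_apply, antighostDer, jetDer_tmul,
    mkDerivation_weight_of_isWeightedHomogeneous ha, extDer_id_of_mem_exteriorPower hb, ← hk]
  simp [TensorProduct.smul_tmul', add_smul]

/-- The lowering derivation on the commuting jets.  The coefficients are such that its commutator
with `∂_ν` is the antighost number. -/
def lowerEven (ν : Fin n) : EvenJet n N → EvenPart n N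
  | .h _ _ _ => 0
  | .Cstar m a α => (2 * m ν : ℝ) • MvPolynomial.X (.Cstar (m - Finsupp.single ν 1) a α)

/-- The lowering derivation on the anticommuting jets. -/
def lowerOddJet (ν : Fin n) : OddJet n N → (OddJet n N →₀ ℝ)
  | .hstar m a s => Finsupp.single (.hstar (m - Finsupp.single ν 1) a s) (m ν : ℝ)

/-- The derivation of the local functions that lowers the order of differentiation of the
antifields in the direction `ν`. -/
def lowering (ν : Fin n) : LocalFun n N →ₗ[ℝ] LocalFun n N :=
  jetDer (lowerEven ν) (Finsupp.linearCombination ℝ (lowerOddJet ν))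

theorem totalDeriv_eq_jetDer (μ : Fin n) : (totalDeriv μ : LocalFun n N →ₗ[ℝ] LocalFun n N) =
    jetDer (fun j => MvPolynomial.X (j.shift μ)) (Finsupp.lmapDomain ℝ ℝ (OddJet.shift μ)) := rfl

/-- Combined with `jetDer_commutator`, this reduces a vanishing commutator to a check on single
jets. -/
theorem jetDer_eq_zero {g : EvenJet n N → EvenPart n N}
    {f : (OddJet n N →₀ ℝ) →ₗ[ℝ] (OddJet n N →₀ ℝ)} (hg : ∀ j, g j = 0)
    (hf : ∀ j, f (Finsupp.single j 1) = 0) (x : LocalFun n N) : jetDer g f x = 0 := by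
  have hf' : f = 0 := Finsupp.lhom_ext' fun j => LinearMap.ext_ring (hf j)
  subst hf'
  induction x using TensorProduct.induction_on with
  | zero => simp
  | add x y hx hy => simp only [map_add, hx, hy, add_zero]
  | tmul a b =>
    have h1 : MvPolynomial.mkDerivation ℝ g = 0 :=
      MvPolynomial.derivation_ext (by simp [hg])
    rw [jetDer_tmul, h1, extDer_zero]
    simp

theorem totalDeriv_comm (μ ν : Fin n) (x : LocalFun n N) :
    totalDeriv μ (totalDeriv ν x) = totalDeriv ν (totalDeriv μ x) := by
  rw [← sub_eq_zero, totalDeriv_eq_jetDer, totalDeriv_eq_jetDer, jetDer_commutator]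
  refine jetDer_eq_zero (fun j => ?_) (fun j => ?_) x
  · rcases j with ⟨m, a, s⟩ | ⟨m, a, s⟩ <;>
      simp [EvenJet.shift, add_right_comm]
  · rcases j with ⟨m, a, s⟩
    simp [OddJet.shift, add_right_comm]

theorem antighostDer_totalDeriv (μ : Fin n) (x : LocalFun n N) :
    antighostDer n N (totalDeriv μ x) = totalDeriv μ (antighostDer n N x) := by
  rw [← sub_eq_zero, totalDeriv_eq_jetDer, antighostDer, jetDer_commutator]
  refine jetDer_eq_zero (fun j => ?_) (fun j => ?_) x
  · rcases j with ⟨m, a, s⟩ | ⟨m, a, s⟩ <;> simp [EvenJet.shift, EvenJet.antigh]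
  · simp

theorem sub_single_add_single {m : Fin n →₀ ℕ} {μ : Fin n} (h : m μ ≠ 0) :
    m - Finsupp.single μ 1 + Finsupp.single μ 1 = m :=
  tsub_add_cancel_of_le (by simpa [Nat.one_le_iff_ne_zero] using h)

theorem add_single_sub_single {μ ν : Fin n} (h : μ ≠ ν) (m : Fin n →₀ ℕ) :
    m + Finsupp.single μ 1 - Finsupp.single ν 1 = m - Finsupp.single ν 1 + Finsupp.single μ 1 := by
  ext i
  have : Finsupp.single μ 1 i = 0 ∨ Finsupp.single ν 1 i = 0 := by
    by_cases hi : i = μ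
    · right; rw [Finsupp.single_apply, if_neg (by rw [hi]; exact h.symm)]
    · left; rw [Finsupp.single_apply, if_neg (Ne.symm hi)]
  simp only [Finsupp.coe_tsub, Finsupp.coe_add, Pi.sub_apply, Pi.add_apply]
  omega

theorem lowering_comm (μ ν : Fin n) (x : LocalFun n N) :
    lowering μ (lowering ν x) = lowering ν (lowering μ x) := by
  rcases eq_or_ne μ ν with rfl | h
  · rfl
  rw [← sub_eq_zero, lowering, lowering, jetDer_commutator]
  refine jetDer_eq_zero (fun j => ?_) (fun j => ?_) x
  · rcases j with ⟨m, a, s⟩ | ⟨m, a, s⟩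
    · simp [lowerEven]
    · simp [lowerEven, h, h.symm, smul_smul, tsub_right_comm, mul_comm]
  · rcases j with ⟨m, a, s⟩
    simp [lowerOddJet, h, h.symm, tsub_right_comm, mul_comm]

/-- On an antifield jet of antighost number `w` the commutator gives `w (m μ + 1) - w (m μ) = w`.
This is the reason for the factors `2 * m ν` and `m ν` in the lowering derivations. -/
theorem lowering_totalDeriv_self (μ : Fin n) (x : LocalFun n N) :
    lowering μ (totalDeriv μ x) = totalDeriv μ (lowering μ x) + antighostDer n N x := by
  rw [← sub_eq_iff_eq_add', totalDeriv_eq_jetDer, lowering, antighostDer, jetDer_commutator]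
  congr 2
  · funext j
    rcases j with ⟨m, a, s⟩ | ⟨m, a, s⟩
    · simp [lowerEven, EvenJet.shift, EvenJet.antigh]
    · simp only [EvenJet.shift, MvPolynomial.mkDerivation_X, lowerEven, EvenJet.antigh]
      -- For `m μ = 0` the truncated subtraction `m - single μ 1` does not lower anything, but its
      -- coefficient vanishes.
      by_cases hm : m μ = 0
      · simp [hm]
      · simp [sub_single_add_single hm, ← sub_smul, mul_add]
  · ext ⟨m, a, s⟩ : 2
    by_cases hm : m μ = 0
    · simp [lowerOddJet, OddJet.shift, hm]
    · simp [lowerOddJet, OddJet.shift, sub_single_add_single hm]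

theorem lowering_totalDeriv_of_ne {μ ν : Fin n} (h : μ ≠ ν) (x : LocalFun n N) :
    lowering ν (totalDeriv μ x) = totalDeriv μ (lowering ν x) := by
  rw [← sub_eq_zero, totalDeriv_eq_jetDer, lowering, jetDer_commutator]
  refine jetDer_eq_zero (fun j => ?_) (fun j => ?_) x
  · rcases j with ⟨m, a, s⟩ | ⟨m, a, s⟩ <;>
      simp [lowerEven, EvenJet.shift, h.symm, add_single_sub_single h]
  · rcases j with ⟨m, a, s⟩
    simp [lowerOddJet, OddJet.shift, h.symm, add_single_sub_single h]

theorem totalDeriv_mem_antighostSubmodule (μ : Fin n) {k : ℕ} {x : LocalFun n N}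
    (hx : x ∈ antighostSubmodule n N k) : totalDeriv μ x ∈ antighostSubmodule n N k := by
  refine jetDer_mem_antighostSubmodule (fun j => ?_) hx
  have h : j.antigh = (j.shift μ).antigh := by cases j <;> rfl
  rw [h]
  exact MvPolynomial.isWeightedHomogeneous_X ℝ _ _

theorem lowering_mem_antighostSubmodule (ν : Fin n) {k : ℕ} {x : LocalFun n N}
    (hx : x ∈ antighostSubmodule n N k) : lowering ν x ∈ antighostSubmodule n N k := by
  refine jetDer_mem_antighostSubmodule (fun j => ?_) hx
  rcases j with ⟨m, a, s⟩ | ⟨m, a, s⟩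
  · exact MvPolynomial.isWeightedHomogeneous_zero ℝ _ _
  · rw [lowerEven, MvPolynomial.smul_eq_C_mul]
    exact (MvPolynomial.isWeightedHomogeneous_X ℝ EvenJet.antigh
      (EvenJet.Cstar (m - Finsupp.single ν 1) a s)).C_mul _

/-! ### Stability of the invariant polynomials -/

section Invariants

theorem antighostDer_hField (a : Fin N) (α β : Fin n) :
    antighostDer n N (hField a α β) = 0 := by
  simp [antighostDer, hField, jetDer_X, EvenJet.antigh]

theorem lowering_hField (ν : Fin n) (a : Fin N) (α β : Fin n) :
    lowering ν (hField a α β : LocalFun n N) = 0 := by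
  simp [lowering, hField, jetDer_X, lowerEven]

theorem lowering_totalDeriv (ν μ : Fin n) (x : LocalFun n N) :
    lowering ν (totalDeriv μ x) =
      totalDeriv μ (lowering ν x) + if μ = ν then antighostDer n N x else 0 := by
  split_ifs with h
  · subst h; exact lowering_totalDeriv_self μ x
  · rw [lowering_totalDeriv_of_ne h, add_zero]

/-- For the curvature, moving the lowering past both total derivatives leaves only `A h` and `T h`,
which are zero. The undifferentiated antifields have nothing to lower. -/
theorem lowering_eq_zero_of_isBasicInvariant (ν : Fin n) {g : LocalFun n N}
    (hg : IsBasicInvariant g) : lowering ν g = 0 := by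
  cases hg with
  | curvature a α β μ ν' =>
    simp [curvature, lowering_totalDeriv, lowering_hField, antighostDer_totalDeriv,
      antighostDer_hField]
  | hStar a α β => simp [lowering, hStar, jetDer_ι, lowerOddJet]
  | CStar a α => simp [lowering, CStar, jetDer_X, lowerEven]

theorem exists_antighostDer_eq_smul {g : LocalFun n N} (hg : IsBasicInvariant g) :
    ∃ c : ℝ, antighostDer n N g = c • g := by
  cases hg with
  | curvature a α β μ ν =>
    exact ⟨0, by simp [curvature, antighostDer_totalDeriv, antighostDer_hField]⟩
  | hStar a α β => exact ⟨1, by simp [antighostDer, hStar, jetDer_ι]⟩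
  | CStar a α =>
    exact ⟨2, by simp [antighostDer, CStar, jetDer_X, EvenJet.antigh, TensorProduct.smul_tmul']⟩

theorem iterTotalDeriv_cons (μ : Fin n) (l : List (Fin n)) (x : LocalFun n N) :
    iterTotalDeriv (μ :: l) x = totalDeriv μ (iterTotalDeriv l x) := rfl

theorem antighostDer_iterTotalDeriv {c : ℝ} {g : LocalFun n N}
    (hg : antighostDer n N g = c • g) (l : List (Fin n)) :
    antighostDer n N (iterTotalDeriv l g) = c • iterTotalDeriv l g := by
  induction l with
  | nil => exact hg
  | cons μ l ih => rw [iterTotalDeriv_cons, antighostDer_totalDeriv, ih, map_smul]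

theorem iterTotalDeriv_mem_invariantPolynomials {g : LocalFun n N} (hg : IsBasicInvariant g)
    (l : List (Fin n)) : iterTotalDeriv l g ∈ invariantPolynomials n N :=
  Algebra.subset_adjoin ⟨l, g, hg, rfl⟩

/-- A derivation preserves the invariant polynomials if it does so on the generators. -/
theorem jetDer_mem_invariantPolynomials {g : EvenJet n N → EvenPart n N}
    {f : (OddJet n N →₀ ℝ) →ₗ[ℝ] (OddJet n N →₀ ℝ)}
    (h : ∀ l x, IsBasicInvariant x → jetDer g f (iterTotalDeriv l x) ∈ invariantPolynomials n N)
    {x : LocalFun n N} (hx : x ∈ invariantPolynomials n N) :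
    jetDer g f x ∈ invariantPolynomials n N := by
  induction hx using Algebra.adjoin_induction with
  | mem x hx =>
    obtain ⟨l, y, hy, rfl⟩ := hx
    exact h l y hy
  | algebraMap r => rw [jetDer_algebraMap]; exact zero_mem _
  | add x y hx hy ihx ihy => rw [map_add]; exact add_mem ihx ihy
  | mul x y hx hy ihx ihy =>
    rw [jetDer_mul]
    exact add_mem (mul_mem ihx hy) (mul_mem hx ihy)

theorem totalDeriv_mem_invariantPolynomials (μ : Fin n) {x : LocalFun n N}
    (hx : x ∈ invariantPolynomials n N) : totalDeriv μ x ∈ invariantPolynomials n N :=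
  jetDer_mem_invariantPolynomials
    (fun l _ hy => iterTotalDeriv_mem_invariantPolynomials hy (μ :: l)) hx

/-- Commuting the lowering through an iterated derivative of a basic invariant removes one
derivative at a time. Each commutator returns a multiple of a shorter iterated derivative, because
basic invariants are eigenvectors of `antighostDer`. -/
theorem lowering_mem_invariantPolynomials (ν : Fin n) {x : LocalFun n N}
    (hx : x ∈ invariantPolynomials n N) : lowering ν x ∈ invariantPolynomials n N := by
  refine jetDer_mem_invariantPolynomials (fun l y hy => ?_) hx
  rw [← lowering]
  induction l with
  | nil =>
    have h := lowering_eq_zero_of_isBasicInvariant ν hy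
    simp [iterTotalDeriv, h]
  | cons μ l ih =>
    obtain ⟨c, hc⟩ := exists_antighostDer_eq_smul hy
    rw [iterTotalDeriv_cons, lowering_totalDeriv, antighostDer_iterTotalDeriv hc]
    refine add_mem (totalDeriv_mem_invariantPolynomials μ ih) ?_
    split_ifs
    · exact Subalgebra.smul_mem _ (iterTotalDeriv_mem_invariantPolynomials hy l) c
    · exact zero_mem _

variable (n N) in
/-- The invariant polynomials of form degree zero and antighost number `k`. -/
def invariantsOfAntighost (k : ℕ) : Submodule ℝ (LocalFun n N) :=
  Subalgebra.toSubmodule (invariantPolynomials n N) ⊓ antighostSubmodule n N k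

theorem totalDeriv_mem_invariantsOfAntighost (μ : Fin n) {k : ℕ} {x : LocalFun n N}
    (hx : x ∈ invariantsOfAntighost n N k) : totalDeriv μ x ∈ invariantsOfAntighost n N k :=
  ⟨totalDeriv_mem_invariantPolynomials μ hx.1, totalDeriv_mem_antighostSubmodule μ hx.2⟩

theorem lowering_mem_invariantsOfAntighost (ν : Fin n) {k : ℕ} {x : LocalFun n N}
    (hx : x ∈ invariantsOfAntighost n N k) : lowering ν x ∈ invariantsOfAntighost n N k :=
  ⟨lowering_mem_invariantPolynomials ν hx.1, lowering_mem_antighostSubmodule ν hx.2⟩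

end Invariants

/-! ### The filtration by nilpotency order of the lowerings -/

section Filtration

variable (n N) in
/-- The local functions annihilated by every product of `j` lowering derivations. -/
def loweringKernel : ℕ → Submodule ℝ (LocalFun n N)
  | 0 => ⊥
  | j + 1 => ⨅ ν, (loweringKernel j).comap (lowering ν)

theorem mem_loweringKernel_succ {j : ℕ} {x : LocalFun n N} :
    x ∈ loweringKernel n N (j + 1) ↔ ∀ ν, lowering ν x ∈ loweringKernel n N j := by
  simp [loweringKernel]

theorem loweringKernel_mono : Monotone (loweringKernel n N) := by
  refine monotone_nat_of_le_succ fun j => ?_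
  induction j with
  | zero => exact bot_le
  | succ j ih =>
    intro x hx
    rw [mem_loweringKernel_succ] at hx ⊢
    exact fun ν => ih (hx ν)

/-- By the Leibniz rule each lowering falls on one of the two factors. The bound `i + j` is not
sharp, but only closure of the union under products is needed. -/
theorem mul_mem_loweringKernel {i j : ℕ} {x y : LocalFun n N} (hx : x ∈ loweringKernel n N i)
    (hy : y ∈ loweringKernel n N j) : x * y ∈ loweringKernel n N (i + j) := by
  induction i generalizing j x y with
  | zero =>
    obtain rfl : x = 0 := hx
    simp
  | succ i ihi =>
    induction j generalizing y with
    | zero =>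
      obtain rfl : y = 0 := hy
      simp
    | succ j ihj =>
      rw [← add_assoc, mem_loweringKernel_succ]
      intro ν
      rw [lowering, jetDer_mul, ← lowering]
      refine add_mem ?_ (ihj (mem_loweringKernel_succ.mp hy ν))
      have h := ihi (mem_loweringKernel_succ.mp hx ν) hy
      rwa [show i + (j + 1) = i + 1 + j by omega] at h

/-- Each lowering either kills the jet or reduces its order of differentiation by one. -/
theorem CStar_jet_mem_loweringKernel (j : ℕ) (m : Fin n →₀ ℕ) (hm : m.degree < j) (a : Fin N)
    (α : Fin n) : (TensorProduct.tmul ℝ (MvPolynomial.X (EvenJet.Cstar m a α)) 1 : LocalFun n N) ∈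
      loweringKernel n N j := by
  induction j generalizing m with
  | zero => omega
  | succ j ih =>
    rw [mem_loweringKernel_succ]
    intro ν
    rw [lowering, jetDer_X, lowerEven, ← TensorProduct.smul_tmul']
    by_cases h : m ν = 0
    · simp [h]
    · refine Submodule.smul_mem _ _ (ih _ ?_)
      have := congrArg Finsupp.degree (sub_single_add_single h)
      simp only [map_add, Finsupp.degree_single] at this
      omega

theorem hStar_jet_mem_loweringKernel (j : ℕ) (m : Fin n →₀ ℕ) (hm : m.degree < j) (a : Fin N)
    (s : Sym2 (Fin n)) : (TensorProduct.tmul ℝ 1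
      (ExteriorAlgebra.ι ℝ (Finsupp.single (OddJet.hstar m a s) 1)) : LocalFun n N) ∈
      loweringKernel n N j := by
  induction j generalizing m with
  | zero => omega
  | succ j ih =>
    rw [mem_loweringKernel_succ]
    intro ν
    rw [lowering, jetDer_ι, Finsupp.linearCombination_single, one_smul, lowerOddJet]
    by_cases h : m ν = 0
    · simp [h]
    · rw [← mul_one (m ν : ℝ), ← smul_eq_mul, ← Finsupp.smul_single, map_smul,
        TensorProduct.tmul_smul]
      refine Submodule.smul_mem _ _ (ih _ ?_)
      have := congrArg Finsupp.degree (sub_single_add_single h)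
      simp only [map_add, Finsupp.degree_single] at this
      omega

variable (n N) in
/-- The local functions on which the lowering derivations act nilpotently. -/
def nilpotentPart : Subalgebra ℝ (LocalFun n N) where
  carrier := {x | ∃ j, x ∈ loweringKernel n N j}
  mul_mem' := fun ⟨_, hi⟩ ⟨_, hj⟩ => ⟨_, mul_mem_loweringKernel hi hj⟩
  add_mem' := fun ⟨_, hi⟩ ⟨_, hj⟩ => ⟨_, add_mem
    (loweringKernel_mono (le_max_left _ _) hi) (loweringKernel_mono (le_max_right _ _) hj)⟩
  algebraMap_mem' := fun r => ⟨1, mem_loweringKernel_succ.mpr fun ν => by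
    rw [lowering, jetDer_algebraMap]; exact zero_mem _⟩

/-- The lowering derivations are locally nilpotent. -/
theorem exists_mem_loweringKernel (x : LocalFun n N) : ∃ j, x ∈ loweringKernel n N j := by
  change x ∈ nilpotentPart n N
  induction x using TensorProduct.induction_on with
  | zero => exact zero_mem _
  | add x y hx hy => exact add_mem hx hy
  | tmul a b =>
    -- Nilpotency passes to sums and products, so it suffices to check generators of the even and
    -- odd factors separately.
    rw [← mul_one a, ← one_mul b, ← Algebra.TensorProduct.tmul_mul_tmul]
    refine mul_mem ?_ ?_
    · change Algebra.TensorProduct.includeLeft (R := ℝ) (S := ℝ) (B := OddPart n N) a ∈ _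
      induction a using MvPolynomial.induction_on with
      | C r => exact (nilpotentPart n N).algebraMap_mem r
      | add p q hp hq => rw [map_add]; exact add_mem hp hq
      | mul_X p j hp =>
        rw [map_mul]
        refine mul_mem hp ?_
        rcases j with ⟨m, a, s⟩ | ⟨m, a, α⟩
        · refine ⟨1, mem_loweringKernel_succ.mpr fun ν => ?_⟩
          rw [Algebra.TensorProduct.includeLeft_apply, lowering, jetDer_X]
          simp [lowerEven]
        · exact ⟨_, CStar_jet_mem_loweringKernel _ m (Nat.lt_succ_self _) a α⟩
    · change Algebra.TensorProduct.includeRight (R := ℝ) (A := EvenPart n N) b ∈ _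
      induction b using ExteriorAlgebra.induction with
      | algebraMap r => rw [AlgHom.commutes]; exact (nilpotentPart n N).algebraMap_mem r
      | add p q hp hq => rw [map_add]; exact add_mem hp hq
      | mul p q hp hq => rw [map_mul]; exact mul_mem hp hq
      | ι v =>
        induction v using Finsupp.induction_linear with
        | zero => rw [map_zero, map_zero]; exact zero_mem _
        | add v w hv hw => rw [map_add, map_add]; exact add_mem hv hw
        | single j r =>
          rcases j with ⟨m, a, s⟩
          rw [← mul_one r, ← smul_eq_mul, ← Finsupp.smul_single, map_smul, map_smul]
          refine (nilpotentPart n N).smul_mem ?_ r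
          exact ⟨_, hStar_jet_mem_loweringKernel _ m (Nat.lt_succ_self _) a s⟩

variable (n N) in
/-- The operator `∑ μ, ∂_μ ∘ T^μ`, where `T` are the lowering derivations. -/
def raiseLower : LocalFun n N →ₗ[ℝ] LocalFun n N :=
  ∑ μ, totalDeriv μ ∘ₗ lowering μ

theorem raiseLower_apply (x : LocalFun n N) :
    raiseLower n N x = ∑ μ, totalDeriv μ (lowering μ x) := by
  simp [raiseLower]

theorem raiseLower_mem_invariantsOfAntighost {k : ℕ} {x : LocalFun n N}
    (hx : x ∈ invariantsOfAntighost n N k) : raiseLower n N x ∈ invariantsOfAntighost n N k := by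
  rw [raiseLower_apply]
  exact sum_mem fun μ _ => totalDeriv_mem_invariantsOfAntighost μ
    (lowering_mem_invariantsOfAntighost μ hx)

/-- The ladder relation `[T^ν, R] = k T^ν`: in `∑ ∂_μ T^μ` only `μ = ν` contributes to the
commutator, and the `T^μ` commute with `T^ν`. -/
theorem lowering_raiseLower {k : ℕ} {x : LocalFun n N} (hx : x ∈ antighostSubmodule n N k)
    (ν : Fin n) :
    lowering ν (raiseLower n N x) = raiseLower n N (lowering ν x) + (k : ℝ) • lowering ν x := by
  have h : ∀ μ, antighostDer n N (lowering μ x) = (k : ℝ) • lowering μ x := fun μ =>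
    antighostDer_of_mem (lowering_mem_antighostSubmodule μ hx)
  simp [raiseLower_apply, lowering_totalDeriv, Finset.sum_add_distrib, h, lowering_comm ν]

/-- On the `j`-th graded piece of the filtration, `raiseLower` is multiplication by `k * j`. -/
theorem raiseLower_sub_mem_loweringKernel {k j : ℕ} {x : LocalFun n N}
    (hx : x ∈ antighostSubmodule n N k) (hj : x ∈ loweringKernel n N (j + 1)) :
    raiseLower n N x - (k * j : ℝ) • x ∈ loweringKernel n N j := by
  induction j generalizing x with
  | zero =>
    have h : ∀ ν, lowering ν x = 0 := mem_loweringKernel_succ.mp hj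
    simp [raiseLower_apply, h]
  | succ j ih =>
    rw [mem_loweringKernel_succ] at hj ⊢
    intro ν
    -- The ladder relation turns `T^ν (R - k (j + 1)) x` into `(R - k j) T^ν x`, which is the
    -- induction hypothesis at `T^ν x`.
    have h := ih (lowering_mem_antighostSubmodule ν hx) (hj ν)
    rw [map_sub, lowering_raiseLower hx, map_smul]
    convert h using 1
    push_cast
    module

end Filtration

/-! ### The horizontal differential, contraction and the homotopy formula -/

section HorizontalD

theorem directionalDeriv_apply (v : Fin n → ℝ) (x : LocalFun n N) :
    directionalDeriv v x = ∑ μ, v μ • totalDeriv μ x := by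
  simp [directionalDeriv]

theorem directionalDeriv_single (μ : Fin n) (x : LocalFun n N) :
    directionalDeriv (Pi.single μ 1) x = totalDeriv μ x := by
  rw [directionalDeriv_apply, Finset.sum_eq_single μ] <;>
    simp +contextual

theorem directionalDeriv_comm (v w : Fin n → ℝ) (x : LocalFun n N) :
    directionalDeriv v (directionalDeriv w x) = directionalDeriv w (directionalDeriv v x) := by
  simp only [directionalDeriv_apply, map_sum, map_smul, Finset.smul_sum]
  rw [Finset.sum_comm]
  refine Finset.sum_congr rfl fun μ _ => Finset.sum_congr rfl fun ν _ => ?_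
  rw [smul_comm, totalDeriv_comm]

variable {p : ℕ}

theorem horizontalD_apply (ω : LocalForm n N p) (v : Fin (p + 1) → Fin n → ℝ) :
    horizontalD ω v =
      ∑ i : Fin (p + 1), (-1) ^ (i : ℕ) • directionalDeriv (v i) (ω (i.removeNth v)) := by
  rw [horizontalD, AlternatingMap.alternatizeUncurryFin_apply]
  rfl

theorem horizontalD_sub (ω η : LocalForm n N p) :
    horizontalD (ω - η) = horizontalD ω - horizontalD η := by
  ext v
  simp [horizontalD_apply, smul_sub]

theorem horizontalD_smul (c : ℝ) (ω : LocalForm n N p) :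
    horizontalD (c • ω) = c • horizontalD ω := by
  ext v
  simp only [horizontalD_apply, AlternatingMap.smul_apply, map_smul, Finset.smul_sum]
  exact Finset.sum_congr rfl fun i _ => smul_comm _ _ _

/-- Total derivatives commute, so the second derivative is symmetric in its two directions and its
alternatization vanishes. -/
theorem horizontalD_horizontalD (ω : LocalForm n N p) : horizontalD (horizontalD ω) = 0 := by
  let f : (Fin n → ℝ) →ₗ[ℝ] (Fin n → ℝ) →ₗ[ℝ] LocalForm n N p :=
    LinearMap.mk₂ ℝ
      (fun v w => (directionalDeriv v ∘ₗ directionalDeriv w).compAlternatingMap ω)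
      (by intros; ext; simp) (by intros; ext; simp) (by intros; ext; simp)
      (by intros; ext; simp)
  have h := AlternatingMap.alternatizeUncurryFin_alternatizeUncurryFinLM_comp_of_symmetric (f := f)
    (fun v w => by ext u; exact directionalDeriv_comm v w (ω u))
  rw [← h]
  ext v
  simp only [horizontalD_apply, AlternatingMap.alternatizeUncurryFin_apply, LinearMap.comp_apply,
    AlternatingMap.alternatizeUncurryFinLM_apply, map_sum, map_zsmul]
  rfl

theorem localForm_sum_apply {ι : Type*} (s : Finset ι) (ω : ι → LocalForm n N p)
    (v : Fin p → Fin n → ℝ) : (∑ i ∈ s, ω i) v = ∑ i ∈ s, ω i v := by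
  classical
  induction s using Finset.induction_on with
  | empty => simp
  | insert i s hi ih =>
    rw [Finset.sum_insert hi, Finset.sum_insert hi, AlternatingMap.add_apply, ih]

/-- Contraction of a form with the lowering derivations. -/
def contract (ω : LocalForm n N (p + 1)) : LocalForm n N p :=
  ∑ ν, (lowering ν).compAlternatingMap (ω.curryLeft (Pi.single ν 1))

theorem contract_apply (ω : LocalForm n N (p + 1)) (v : Fin p → Fin n → ℝ) :
    contract ω v = ∑ ν, lowering ν (ω (Matrix.vecCons (Pi.single ν 1) v)) := by
  simp [contract, localForm_sum_apply]

theorem sum_smul_apply_vecCons (ω : LocalForm n N (p + 1)) (w : Fin n → ℝ)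
    (v : Fin p → Fin n → ℝ) :
    ∑ ν, w ν • ω (Matrix.vecCons (Pi.single ν 1) v) = ω (Matrix.vecCons w v) := by
  have h : w = ∑ ν, w ν • (Pi.single ν 1 : Fin n → ℝ) := by
    ext i
    simp [Pi.single_apply]
  simp only [← AlternatingMap.curryLeft_apply_apply]
  conv_rhs => rw [h, map_sum, localForm_sum_apply]
  simp only [map_smul, AlternatingMap.smul_apply]

theorem lowering_directionalDeriv {k : ℕ} {x : LocalFun n N} (hx : x ∈ antighostSubmodule n N k)
    (w : Fin n → ℝ) (ν : Fin n) : lowering ν (directionalDeriv w x) =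
      directionalDeriv w (lowering ν x) + (k : ℝ) • w ν • x := by
  simp [directionalDeriv_apply, lowering_totalDeriv, smul_add, Finset.sum_add_distrib,
    antighostDer_of_mem hx, smul_comm (k : ℝ)]

/-- The first term of `horizontalD`, on a tuple with a prepended vector, split off. -/
theorem horizontalD_vecCons (ω : LocalForm n N p) (e : Fin n → ℝ) (v : Fin p → Fin n → ℝ) :
    horizontalD ω (Matrix.vecCons e v) = directionalDeriv e (ω v) -
      ∑ i : Fin p, (-1) ^ (i : ℕ) •
        directionalDeriv (v i) (ω (i.succ.removeNth (Matrix.vecCons e v : Fin (p + 1) → _))) := by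
  rw [horizontalD_apply, Fin.sum_univ_succ, sub_eq_add_neg, ← Finset.sum_neg_distrib]
  congr 1
  · simp
  · refine Finset.sum_congr rfl fun i _ => ?_
    simp [pow_succ]

/-- Each of the `n` directions contributes one commutator, equal to `k` on `x`; this is the source
of `k n` in the homotopy formula. -/
theorem sum_lowering_totalDeriv {k : ℕ} {x : LocalFun n N} (hx : x ∈ antighostSubmodule n N k) :
    ∑ ν, lowering ν (totalDeriv ν x) = raiseLower n N x + (k * n : ℝ) • x := by
  simp only [lowering_totalDeriv_self, antighostDer_of_mem hx, Finset.sum_add_distrib,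
    raiseLower_apply, Finset.sum_const, Finset.card_univ, Fintype.card_fin]
  rw [← Nat.cast_smul_eq_nsmul ℝ, smul_smul, mul_comm]

theorem contract_horizontalD_zero {k : ℕ} {ω : LocalForm n N 0}
    (hω : ∀ v, ω v ∈ antighostSubmodule n N k) (v : Fin 0 → Fin n → ℝ) :
    contract (horizontalD ω) v = raiseLower n N (ω v) + (k * n : ℝ) • ω v := by
  simp only [contract_apply, horizontalD_vecCons, directionalDeriv_single, Finset.univ_eq_empty,
    Finset.sum_empty, sub_zero]
  exact sum_lowering_totalDeriv (hω v)

/-- The homotopy formula for `horizontalD` and `contract`. -/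
theorem contract_horizontalD_succ {k : ℕ} {ω : LocalForm n N (p + 1)}
    (hω : ∀ v, ω v ∈ antighostSubmodule n N k) (v : Fin (p + 1) → Fin n → ℝ) :
    contract (horizontalD ω) v + horizontalD (contract ω) v =
      raiseLower n N (ω v) + (k * (n - (p + 1)) : ℝ) • ω v := by
  have hcons : ∀ (i : Fin (p + 1)) (e : Fin n → ℝ),
      i.succ.removeNth (Matrix.vecCons e v : Fin (p + 2) → Fin n → ℝ) =
        Matrix.vecCons e (i.removeNth v) := by
    intro i e
    ext j : 1
    refine Fin.cases ?_ (fun j => ?_) j <;> simp [Fin.removeNth_apply]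
  -- The commutator puts `v i` back into the first slot of `ω`; moving it to position `i` cancels
  -- the sign. The `p + 1` resulting copies of `k • ω v` are what reduces `k n` to `k (n - (p +
  -- 1))`.
  have hterm : ∀ i : Fin (p + 1), ∑ ν, (-1 : ℤ) ^ (i : ℕ) • lowering ν (directionalDeriv (v i)
      (ω (Matrix.vecCons (Pi.single ν 1) (i.removeNth v)))) =
      (-1 : ℤ) ^ (i : ℕ) • directionalDeriv (v i) (contract ω (i.removeNth v)) +
        (k : ℝ) • ω v := by
    intro i
    simp only [lowering_directionalDeriv (hω _), ← Finset.smul_sum, Finset.sum_add_distrib,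
      sum_smul_apply_vecCons, contract_apply, map_sum, smul_add]
    rw [smul_comm _ (k : ℝ), ← AlternatingMap.map_insertNth, Fin.insertNth_self_removeNth]
  simp only [contract_apply (horizontalD ω), horizontalD_vecCons, directionalDeriv_single, map_sub,
    Finset.sum_sub_distrib, sum_lowering_totalDeriv (hω v), hcons, map_sum, map_zsmul]
  rw [Finset.sum_comm]
  simp only [hterm, Finset.sum_add_distrib, ← horizontalD_apply, Finset.sum_const,
    Finset.card_univ, Fintype.card_fin]
  rw [← Nat.cast_smul_eq_nsmul ℝ]
  push_cast
  module

end HorizontalD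

/-! ### Induction on the filtration -/

section Cohomology

variable {p k : ℕ}

theorem mem_invariantForms {ω : LocalForm n N p} :
    ω ∈ invariantForms n N p k ↔ ∀ v, ω v ∈ invariantsOfAntighost n N k := Iff.rfl

theorem contract_mem_invariantForms {ω : LocalForm n N (p + 1)}
    (hω : ω ∈ invariantForms n N (p + 1) k) : contract ω ∈ invariantForms n N p k := by
  rw [mem_invariantForms] at hω ⊢
  intro v
  rw [contract_apply]
  exact sum_mem fun ν _ => lowering_mem_invariantsOfAntighost ν (hω _)

theorem zero_mem_invariantForms : (0 : LocalForm n N p) ∈ invariantForms n N p k :=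
  mem_invariantForms.mpr fun _ => zero_mem _

theorem isInvariantlyExact_zero : IsInvariantlyExact k (0 : LocalForm n N p) := by
  cases p with
  | zero => rfl
  | succ p =>
    exact ⟨0, zero_mem_invariantForms, by simpa using horizontalD_smul 0 (0 : LocalForm n N p)⟩

/-- The coefficients of a form are simultaneously annihilated by long enough products of lowering
derivations. -/
theorem exists_forall_mem_loweringKernel (ω : LocalForm n N p) :
    ∃ j, ∀ v, ω v ∈ loweringKernel n N j := by
  choose J hJ using fun s : Fin p → Fin n =>
    exists_mem_loweringKernel (ω fun i => Pi.single (s i) 1)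
  refine ⟨Finset.univ.sup J, fun v => ?_⟩
  set F := loweringKernel n N (Finset.univ.sup J)
  -- Modulo `F` the form vanishes on basis tuples, of which there are finitely many, hence
  -- everywhere.
  have h : F.mkQ.compAlternatingMap ω = 0 := by
    refine Module.Basis.ext_alternating (Pi.basisFun ℝ (Fin n)) fun s _ => ?_
    simp only [Pi.basisFun_apply, LinearMap.compAlternatingMap_apply, AlternatingMap.zero_apply,
      Submodule.mkQ_apply, Submodule.Quotient.mk_eq_zero]
    exact loweringKernel_mono (Finset.le_sup (Finset.mem_univ s)) (hJ s)
  simpa using DFunLike.congr_fun h v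

/-- The homotopy operator is a nonzero scalar up to a remainder one step lower in the filtration,
and the induction absorbs that remainder. -/
theorem isInvariantlyExact_of_loweringKernel (hp : p < n) (hk : 0 < k) (j : ℕ)
    {ω : LocalForm n N p} (hω : ω ∈ invariantForms n N p k)
    (hj : ∀ v, ω v ∈ loweringKernel n N j) (hd : horizontalD ω = 0) :
    IsInvariantlyExact k ω := by
  induction j generalizing ω with
  | zero =>
    obtain rfl : ω = 0 := AlternatingMap.ext hj
    exact isInvariantlyExact_zero
  | succ j ih =>
    have hω' := mem_invariantForms.mp hω
    -- `η` is the failure of `R` to act on `ω` as its eigenvalue `k j` on the graded piece.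
    set η : LocalForm n N p := (raiseLower n N).compAlternatingMap ω - (k * j : ℝ) • ω with hη
    have hη_inv : η ∈ invariantForms n N p k := mem_invariantForms.mpr fun v =>
      sub_mem (raiseLower_mem_invariantsOfAntighost (hω' v)) (Submodule.smul_mem _ _ (hω' v))
    have hη_ker : ∀ v, η v ∈ loweringKernel n N j := fun v =>
      raiseLower_sub_mem_loweringKernel (hω' v).2 (hj v)
    have hk' : (0 : ℝ) < k := Nat.cast_pos.mpr hk
    have hc : (k * (n - p + j) : ℝ) ≠ 0 := by
      have : (p : ℝ) < n := Nat.cast_lt.mpr hp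
      have : (0 : ℝ) < n - p + j := by linarith [(Nat.cast_nonneg j : (0 : ℝ) ≤ j)]
      positivity
    cases p with
    | zero =>
      -- A `0`-form has no contraction, so closedness makes `η` a multiple of `ω`. Thus `η` is
      -- closed and zero by induction, which forces `ω = 0`.
      have h : (0 : LocalForm n N 0) = η + (k * (n - (0 : ℕ) + j) : ℝ) • ω := by
        ext v
        have h := contract_horizontalD_zero (fun v => (hω' v).2) v
        rw [hd, contract_apply] at h
        simp only [AlternatingMap.zero_apply, map_zero, Finset.sum_const_zero] at h
        simp only [hη, AlternatingMap.zero_apply, AlternatingMap.add_apply,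
          AlternatingMap.sub_apply, AlternatingMap.smul_apply,
          LinearMap.compAlternatingMap_apply]
        rw [h]
        push_cast
        module
      have hη_eq : η = (-(k * (n - (0 : ℕ) + j) : ℝ)) • ω := by
        ext v
        have hv := DFunLike.congr_fun h v
        simp only [AlternatingMap.zero_apply, AlternatingMap.add_apply,
          AlternatingMap.smul_apply] at hv ⊢
        rw [neg_smul]
        exact eq_neg_of_add_eq_zero_left hv.symm
      have hη_zero : η = 0 := ih hη_inv hη_ker (by rw [hη_eq, horizontalD_smul, hd, smul_zero])
      rw [hη_zero, zero_add] at h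
      exact (smul_eq_zero.mp h.symm).resolve_left hc
    | succ p =>
      have h : horizontalD (contract ω) = η + (k * (n - (p + 1 : ℕ) + j) : ℝ) • ω := by
        ext v
        have h := contract_horizontalD_succ (fun v => (hω' v).2) v
        rw [hd, contract_apply] at h
        simp only [AlternatingMap.zero_apply, map_zero, Finset.sum_const_zero, zero_add] at h
        simp only [hη, AlternatingMap.add_apply, AlternatingMap.sub_apply,
          AlternatingMap.smul_apply, LinearMap.compAlternatingMap_apply]
        rw [h]
        push_cast
        module
      have hη_eq : η = horizontalD (contract ω) - (k * (n - (p + 1 : ℕ) + j) : ℝ) • ω := by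
        rw [h]
        ext v
        simp
      -- `η` is closed as the difference of an exact form and a multiple of `ω`. With `η = d β`, the
      -- formula `h` reads `d (i ω - β) = c ω`, and dividing by `c` gives the primitive.
      obtain ⟨β, hβ, hβη⟩ := ih hη_inv hη_ker (by
        rw [hη_eq, horizontalD_sub, horizontalD_smul, hd, horizontalD_horizontalD, smul_zero]
        ext v
        simp)
      refine ⟨(k * (n - (p + 1 : ℕ) + j) : ℝ)⁻¹ • (contract ω - β),
        mem_invariantForms.mpr fun v => Submodule.smul_mem _ _
          (sub_mem (mem_invariantForms.mp (contract_mem_invariantForms hω) v) (hβ v)), ?_⟩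
      rw [horizontalD_smul, horizontalD_sub, h, hβη]
      ext v
      simp only [AlternatingMap.smul_apply, AlternatingMap.sub_apply, AlternatingMap.add_apply,
        add_sub_cancel_left]
      rw [smul_smul, inv_mul_cancel₀ hc, one_smul]

end Cohomology

end FreeSpinTwo

end

theorem theorem2p2 (n N p k : ℕ) (hp : p < n) (hk : 0 < k)
    (α : FreeSpinTwo.LocalForm n N p) (hα : α ∈ FreeSpinTwo.invariantForms n N p k)
    (hd : FreeSpinTwo.horizontalD α = 0) :
    FreeSpinTwo.IsInvariantlyExact k α := by
  obtain ⟨j, hj⟩ := FreeSpinTwo.exists_forall_mem_loweringKernel α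
  exact FreeSpinTwo.isInvariantlyExact_of_loweringKernel hp hk j hα hj hd
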